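/- Let $F$ be a probability distribution on $[0,1]$ with second moment $\delta=\int x^2\,dF(x)>0$. For $n\ge 1$ let $(X,A)\sim\mathrm{RDPG}(F)$ be the one-dimensional random dot product graph on $n$ vertices: $X=(X_1,\dots,X_n)^\top$ has independent entries with law $F$, and $A\in\{0,1\}^{n\times n}$ is a symmetric matrix with zero diagonal whose entries $A_{ij}$, $i<j$, are, conditionally on $X$, independent with $A_{ij}\sim\mathrm{Bern}(X_iX_j)$. Let $P=XX^\top$, let $\lambda_1(\cdot)$ denote the largest eigenvalue of a symmetric matrix, $\hat\lambda=\lambda_1(A)$, and let $\|X\|$ be the Euclidean norm of $X$. Then the following hold. (i) $\sqrt n\,\bigl(1-\hat\lambda^{-1/2}\|X\|\bigr)\to 0$ in probability as $n\to\infty$. (ii) There is a universal constant $C>0$ (independent of $F$, $\delta$, $n$ and $\eta$) such that for every $n\ge 1$ and every $0<\eta\le 1/2$, $$\Pr\Bigl[\,\bigl|\hat\lambda-\|X\|^2\bigr|\le \frac{C\log(n/\eta)}{\delta^2}\Bigr]\ge 1-\eta .$$ (iii) Consequently the top eigenvalue of $A$ is within $O(\log n)$ of that of $P$ with high probability: $\lambda_1(P)=\|X\|^2$,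 and for every $c>0$ there is a constant $C>0$ depending only on $F$ and $c$ such that for every $n\ge 2$, $$\Pr\bigl[\,|\lambda_1(A)-\lambda_1(P)|\le C\log n\,\bigr]\ge 1-n^{-c}.$$ (In (i), the value given to $\hat\lambda^{-1/2}$ on the event $\hat\lambda=0$, whose probability tends to $0$, is immaterial.) -/

import Mathlib

open MeasureTheory ProbabilityTheory Filter Topology

noncomputable section

/-- The largest eigenvalue `λ₁(M)` of a real square matrix
(used for symmetric matrices of positive size, where the set below is finite and nonempty). -/
def topEigenvalue {n : ℕ} (M : Matrix (Fin n) (Fin n) ℝ) : ℝ :=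
  sSup {t : ℝ | Module.End.HasEigenvalue (Matrix.toLin' M) t}

/-- The Euclidean norm of a vector of latent positions. -/
def l2norm {n : ℕ} (x : Fin n → ℝ) : ℝ := ‖WithLp.toLp 2 x‖

/-- The second moment `δ = 𝔼[X₁²]` of the latent position distribution. -/
def secondMoment (F : Measure ℝ) : ℝ := ∫ x, x ^ 2 ∂F

/-- `(X, A) ∼ RDPG(F)` on `n` vertices, in dimension one: the latent positions `X₁, …, Xₙ` are
i.i.d. with law `F`, and `A` is a symmetric hollow `0/1` matrix whose entries above the diagonal
are, conditionally on the latent positions, independent with `A i j ∼ Bern(X i * X j)`. -/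
structure IsRDPG (F : Measure ℝ) (n : ℕ) {Ω : Type*} [MeasurableSpace Ω] (μ : Measure Ω)
    (X : Ω → Fin n → ℝ) (A : Ω → Matrix (Fin n) (Fin n) ℝ) : Prop where
  measurable_X : Measurable X
  measurable_A : ∀ i j, Measurable fun ω => A ω i j
  indep_X : iIndepFun (fun i ω => X ω i) μ
  law_X : ∀ i, μ.map (fun ω => X ω i) = F
  symm_A : ∀ ω, (A ω).IsSymm
  hollow_A : ∀ ω i, A ω i i = 0
  zero_one_A : ∀ ω i j, A ω i j = 0 ∨ A ω i j = 1
  /-- The conditional joint law, given `X`, of the entries above the diagonal is the product of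
  the Bernoulli laws: every `0/1` pattern `a` has the product of the Bernoulli weights as its
  conditional probability. -/
  cond_A : ∀ a : Fin n → Fin n → Bool,
    μ⟦{ω | ∀ i j, i < j → A ω i j = if a i j then 1 else 0} |
        MeasurableSpace.comap X inferInstance⟧
      =ᵐ[μ] fun ω => ∏ i, ∏ j ∈ Finset.Ioi i,
        if a i j then X ω i * X ω j else 1 - X ω i * X ω j

end

open Matrix RealInnerProductSpace

/-! ### The largest eigenvalue of a symmetric matrix -/

/-! Write `A = x xᵀ - diag(x i ^ 2) + W` with `W` the centred off-diagonal noise, and `r = ‖x‖²`.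
Since `‖W‖` is of order `√n`, Weyl's inequality would only give an error `√n`. The gain is second
order: `W` moves the top eigenvalue by about `xᵀWx / r`, with a remainder at most `2‖W‖² / r`
(`inner_sq_add_inner_le`); the diagonal costs at most `1`. The lower bound needs only the test
vector `x`.

Three tail bounds then suffice: `r ≥ nδ/2` by Hoeffding; `xᵀWx / r = O(√log(1/η))` by Hoeffding
conditionally on `X`; and `‖W‖ = O(√n)` by a union bound over a net. The remainder is thus `O(1/δ)`.
If `n` is too small for these bounds, `|λ̂ - r| ≤ n` is already good enough. The limit in
probability follows on taking `η = 1/n` and dividing by `λ̂ ≍ n`; the `O(log n)` bound follows with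
`η` a power of `n`. -/

theorem l2norm_sq {n : ℕ} (x : Fin n → ℝ) : l2norm x ^ 2 = x ⬝ᵥ x := by
  rw [l2norm, EuclideanSpace.norm_sq_eq]
  simp [dotProduct, sq]

theorem hasEigenvalue_toLin'_iff {n : ℕ} (M : Matrix (Fin n) (Fin n) ℝ) (t : ℝ) :
    Module.End.HasEigenvalue (Matrix.toLin' M) t ↔ ∃ v ≠ 0, M *ᵥ v = t • v := by
  constructor
  · intro h
    obtain ⟨v, hv⟩ := h.exists_hasEigenvector
    exact ⟨v, hv.2, by simpa using hv.apply_eq_smul⟩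
  · rintro ⟨v, hv, h⟩
    refine Module.End.hasEigenvalue_of_hasEigenvector (x := v) ⟨?_, hv⟩
    rw [Module.End.mem_eigenspace_iff]
    simpa using h

theorem topEigenvalue_le {n : ℕ} {M : Matrix (Fin n) (Fin n) ℝ} {b : ℝ} (hb : 0 ≤ b)
    (h : ∀ v : Fin n → ℝ, v ⬝ᵥ v = 1 → v ⬝ᵥ M *ᵥ v ≤ b) : topEigenvalue M ≤ b := by
  -- There may be no eigenvalue (for instance when `n = 0`), and then the supremum is `0`; hence `0
  -- ≤ b`.
  refine Real.sSup_le ?_ hb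
  intro t ht
  obtain ⟨v, hv, hMv⟩ := (hasEigenvalue_toLin'_iff M t).1 ht
  have hl : 0 < l2norm v := by
    rw [l2norm, norm_pos_iff]
    simpa using hv
  have hvv : v ⬝ᵥ v = l2norm v ^ 2 := (l2norm_sq v).symm
  have := h ((l2norm v)⁻¹ • v) (by
    rw [smul_dotProduct, dotProduct_smul, hvv]; simp only [smul_eq_mul]; field_simp)
  rw [mulVec_smul, hMv, smul_dotProduct, dotProduct_smul, dotProduct_smul, hvv] at this
  simp only [smul_eq_mul] at this
  convert this using 1
  field_simp

/-- In finite dimension the supremum of the Rayleigh quotient of a symmetric operator is itself an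
eigenvalue. -/
theorem dotProduct_mulVec_le_topEigenvalue {n : ℕ} {M : Matrix (Fin n) (Fin n) ℝ}
    (hM : M.IsSymm) (v : Fin n → ℝ) : v ⬝ᵥ M *ᵥ v ≤ topEigenvalue M * (v ⬝ᵥ v) := by
  by_cases hv : v = 0
  · simp [hv]
  set T := Matrix.toEuclideanCLM (n := Fin n) (𝕜 := ℝ) M with hT
  have hsymm : (T : EuclideanSpace ℝ (Fin n) →ₗ[ℝ] EuclideanSpace ℝ (Fin n)).IsSymmetric := by
    intro x y
    change ⟪T x, y⟫ = ⟪x, T y⟫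
    rw [real_inner_comm, inner_toEuclideanCLM, inner_toEuclideanCLM, dotProduct_mulVec,
      dotProduct_comm, ← mulVec_transpose, hM.eq]
  have hv' : WithLp.toLp 2 v ≠ 0 := by simpa using hv
  have : Nontrivial (EuclideanSpace ℝ (Fin n)) := ⟨⟨_, _, hv'⟩⟩
  have hev := hsymm.hasEigenvalue_iSup_of_finiteDimensional
  set s := ⨆ x : { x : EuclideanSpace ℝ (Fin n) // x ≠ 0 },
    RCLike.re ⟪(T : EuclideanSpace ℝ (Fin n) →ₗ[ℝ] EuclideanSpace ℝ (Fin n)) x, (x : _)⟫ /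
      ‖(x : EuclideanSpace ℝ (Fin n))‖ ^ 2 with hs
  have hle : s ≤ topEigenvalue M := by
    refine le_csSup (Module.End.finite_hasEigenvalue (Matrix.toLin' M)).bddAbove ?_
    refine (hasEigenvalue_toLin'_iff M s).2 ?_
    obtain ⟨w, hw⟩ := hev.exists_hasEigenvector
    refine ⟨w.ofLp, by simpa using hw.2, ?_⟩
    have := congrArg WithLp.ofLp hw.apply_eq_smul
    simpa [hT] using this
  have hbdd : BddAbove (Set.range fun x : { x : EuclideanSpace ℝ (Fin n) // x ≠ 0 } =>
      RCLike.re ⟪(T : EuclideanSpace ℝ (Fin n) →ₗ[ℝ] EuclideanSpace ℝ (Fin n)) x, (x : _)⟫ /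
      ‖(x : EuclideanSpace ℝ (Fin n))‖ ^ 2) := by
    refine ⟨‖T‖, ?_⟩
    rintro _ ⟨x, rfl⟩
    exact (le_abs_self _).trans (T.rayleighQuotient_le_norm x)
  have hray := le_ciSup hbdd ⟨_, hv'⟩
  rw [← hs] at hray
  have hpos : 0 < v ⬝ᵥ v := by
    rw [← l2norm_sq, l2norm]; positivity
  have e1 : ‖WithLp.toLp 2 v‖ ^ 2 = v ⬝ᵥ v := l2norm_sq v
  have e2 : ⟪T (WithLp.toLp 2 v), WithLp.toLp 2 v⟫ = v ⬝ᵥ M *ᵥ v := by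
    rw [real_inner_comm, inner_toEuclideanCLM]
  have hray' : v ⬝ᵥ M *ᵥ v / (v ⬝ᵥ v) ≤ s := by
    rw [← e1, ← e2]; exact hray
  rw [div_le_iff₀ hpos] at hray'
  exact hray'.trans (by gcongr)

theorem topEigenvalue_vecMulVec_self {n : ℕ} (x : Fin n → ℝ) :
    topEigenvalue (vecMulVec x x) = l2norm x ^ 2 := by
  have hmul (v : Fin n → ℝ) : v ⬝ᵥ vecMulVec x x *ᵥ v = (x ⬝ᵥ v) ^ 2 := by
    rw [vecMulVec_mulVec]
    simp [dotProduct_comm v x, sq]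
  apply le_antisymm
  · refine topEigenvalue_le (sq_nonneg _) fun v hv => ?_
    rw [hmul]
    have := abs_real_inner_le_norm (WithLp.toLp 2 v) (WithLp.toLp 2 x)
    have h1 : ‖WithLp.toLp 2 v‖ = 1 := by
      have : l2norm v ^ 2 = 1 := by rw [l2norm_sq, hv]
      exact (pow_eq_one_iff_of_nonneg (norm_nonneg _) two_ne_zero).1 this
    rw [h1, one_mul, EuclideanSpace.inner_toLp_toLp] at this
    exact sq_le_sq' (by simpa [l2norm] using (abs_le.1 this).1)
      (by simpa [l2norm] using (abs_le.1 this).2)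
  · have hs : (vecMulVec x x).IsSymm := by
      ext i j; simp [vecMulVec_apply, mul_comm]
    have := dotProduct_mulVec_le_topEigenvalue hs x
    rw [hmul] at this
    rw [l2norm_sq]
    by_cases h : x ⬝ᵥ x = 0
    · rw [dotProduct_self_eq_zero] at h
      subst h
      simp only [dotProduct_zero]
      refine Real.sSup_nonneg fun t ht => ?_
      obtain ⟨v, hv, h⟩ := (hasEigenvalue_toLin'_iff _ _).1 ht
      have h0 : t • v = 0 := by rw [← h]; simp
      exact ((smul_eq_zero.1 h0).resolve_right hv).ge
    · have hp : 0 < x ⬝ᵥ x := lt_of_le_of_ne (by rw [← l2norm_sq]; positivity) (Ne.symm h)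
      nlinarith

/-! ### Second-order perturbation of a rank-one form -/

/-- Split `u = a • x + w` with `w ⊥ x`. The cross term is first order in `T`, at most `2‖T‖‖w‖`, but
tilting `u` away from `x` lowers `⟪x, u⟫ ^ 2` by `‖x‖²‖w‖²`. Completing the square leaves an error
quadratic in `‖T‖`. -/
theorem inner_sq_add_inner_le {E : Type*} [NormedAddCommGroup E] [InnerProductSpace ℝ E]
    {T : E →L[ℝ] E} (hT : (T : E →ₗ[ℝ] E).IsSymmetric) {x u : E} (hx : x ≠ 0) (hu : ‖u‖ = 1) :
    ⟪x, u⟫ ^ 2 + ⟪u, T u⟫ ≤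
      ‖x‖ ^ 2 + |⟪x, T x⟫| / ‖x‖ ^ 2 + 2 * ‖T‖ ^ 2 / ‖x‖ ^ 2 := by
  have hx0 : 0 < ‖x‖ := norm_pos_iff.2 hx
  set r := ‖x‖ ^ 2 with hr
  have hr0 : 0 < r := by positivity
  set B := ‖T‖ with hB
  have hB0 : 0 ≤ B := norm_nonneg _
  have hform (y z : E) : |⟪y, T z⟫| ≤ B * ‖y‖ * ‖z‖ := by
    calc |⟪y, T z⟫| ≤ ‖y‖ * ‖T z‖ := abs_real_inner_le_norm _ _
      _ ≤ ‖y‖ * (B * ‖z‖) := by gcongr; exact T.le_opNorm z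
      _ = _ := by ring
  set a := ⟪x, u⟫ / r with ha
  set w := u - a • x with hw
  have hxw : ⟪x, w⟫ = 0 := by
    rw [hw, inner_sub_right, inner_smul_right, real_inner_self_eq_norm_sq, ← hr, ha]
    field_simp; ring
  have hu' : u = a • x + w := by simp [hw]
  have hnorm : a ^ 2 * r + ‖w‖ ^ 2 = 1 := by
    have : ‖u‖ ^ 2 = ‖a • x‖ ^ 2 + ‖w‖ ^ 2 := by
      rw [hu', norm_add_sq_real, inner_smul_left, hxw]; simp
    rw [hu, norm_smul, mul_pow, Real.norm_eq_abs, sq_abs, ← hr] at this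
    linarith
  have hxu : ⟪x, u⟫ = a * r := by rw [ha]; field_simp
  have hexp : ⟪u, T u⟫ = a ^ 2 * ⟪x, T x⟫ + 2 * (a * ⟪x, T w⟫) + ⟪w, T w⟫ := by
    have h1 : ⟪w, T x⟫ = ⟪x, T w⟫ := by
      rw [real_inner_comm]; exact hT x w
    rw [hu']
    simp only [map_add, map_smul, inner_add_left, inner_add_right, inner_smul_left,
      inner_smul_right, h1]
    simp
    ring
  set b := ‖w‖ with hb
  have hb0 : 0 ≤ b := norm_nonneg _
  have hww : ⟪w, T w⟫ ≤ B * b ^ 2 := by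
    have := (le_abs_self _).trans (hform w w)
    linarith
  -- Half of the loss `r * b ^ 2` absorbs the cross term and the other half absorbs `⟪w, T w⟫`,
  -- which needs `2 * B ≤ r`. Otherwise `B ≤ 2 * B ^ 2 / r` and the trivial bound `r + B` is enough.
  by_cases hcase : 2 * B ≤ r
  · have h1 : a ^ 2 * ⟪x, T x⟫ ≤ |⟪x, T x⟫| / r := by
      have : a ^ 2 ≤ 1 / r := by rw [le_div_iff₀ hr0]; nlinarith
      calc a ^ 2 * ⟪x, T x⟫ ≤ a ^ 2 * |⟪x, T x⟫| := by gcongr; exact le_abs_self _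
        _ ≤ 1 / r * |⟪x, T x⟫| := by gcongr
        _ = _ := by ring
    have h2 : a * ⟪x, T w⟫ ≤ B * b := by
      have hax : |a| * ‖x‖ ≤ 1 := by
        have : (|a| * ‖x‖) ^ 2 ≤ 1 := by rw [mul_pow, sq_abs, ← hr]; nlinarith
        exact (sq_le_one_iff₀ (by positivity)).1 this
      calc a * ⟪x, T w⟫ ≤ |a| * |⟪x, T w⟫| := by rw [← abs_mul]; exact le_abs_self _
        _ ≤ |a| * (B * ‖x‖ * b) := by gcongr; exact hform x w
        _ = (|a| * ‖x‖) * (B * b) := by ring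
        _ ≤ 1 * (B * b) := by gcongr
        _ = B * b := one_mul _
    have h3 : 2 * (B * b) ≤ r * b ^ 2 / 2 + 2 * B ^ 2 / r := by
      have : 0 ≤ (r * b - 2 * B) ^ 2 / (2 * r) := by positivity
      have e : (r * b - 2 * B) ^ 2 / (2 * r) = r * b ^ 2 / 2 + 2 * B ^ 2 / r - 2 * (B * b) := by
        field_simp; ring
      linarith
    have h4 : ⟪x, u⟫ ^ 2 = r - r * b ^ 2 := by
      rw [hxu]; nlinarith
    have h5 : B * b ^ 2 ≤ r * b ^ 2 / 2 := by nlinarith [sq_nonneg b]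
    rw [hexp, h4]
    linarith
  · push Not at hcase
    have h1 : ⟪x, u⟫ ^ 2 ≤ r := by
      have := abs_real_inner_le_norm x u
      rw [hu, mul_one] at this
      rw [hr]; exact sq_le_sq' (by linarith [(abs_le.1 this).1]) (abs_le.1 this).2
    have h2 : ⟪u, T u⟫ ≤ B := by simpa [hu] using (le_abs_self _).trans (hform u u)
    have h3 : B ≤ 2 * B ^ 2 / r := by rw [le_div_iff₀ hr0]; nlinarith
    have h4 : 0 ≤ |⟪x, T x⟫| / r := by positivity
    linarith

/-! ### Nets and the operator norm -/

/-- The unit ball of a finite-dimensional space has a `1/2`-net of at most `5 ^ dim` points. -/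
theorem exists_half_net (E : Type*) [NormedAddCommGroup E] [NormedSpace ℝ E]
    [FiniteDimensional ℝ E] :
    ∃ s : Finset E, s.card ≤ 5 ^ Module.finrank ℝ E ∧ (∀ c ∈ s, ‖c‖ ≤ 1) ∧
      ∀ u : E, ‖u‖ ≤ 1 → ∃ c ∈ s, ‖u - c‖ ≤ 1 / 2 := by
  classical
  let good (s : Finset E) : Prop :=
    (∀ c ∈ s, ‖c‖ ≤ 1) ∧ ∀ c ∈ s, ∀ d ∈ s, c ≠ d → 1 / 2 ≤ ‖c - d‖
  have hcard (s : Finset E) (hs : good s) : s.card ≤ 5 ^ Module.finrank ℝ E := by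
    have hinj : Function.Injective (fun c : E => (2 : ℝ) • c) :=
      smul_right_injective E two_ne_zero
    rw [← Finset.card_image_of_injective s hinj]
    refine Besicovitch.card_le_of_separated _ ?_ ?_
    · simp only [Finset.mem_image]
      rintro _ ⟨c, hc, rfl⟩
      rw [norm_smul]; simpa using hs.1 c hc
    · simp only [Finset.mem_image]
      rintro _ ⟨c, hc, rfl⟩ _ ⟨d, hd, rfl⟩ hcd
      have := hs.2 c hc d hd (fun h => hcd (by rw [h]))
      rw [← smul_sub, norm_smul]
      norm_num at *
      linarith
  -- A `1/2`-separated set of maximal cardinality is a net, since an uncovered point could be added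
  -- to it. The volume bound `hcard` makes the maximum exist.
  let P (k : ℕ) : Prop := ∃ s : Finset E, good s ∧ s.card = k
  have hP0 : P 0 := ⟨∅, by simp [good], rfl⟩
  obtain ⟨s, hs, hsk⟩ : P (Nat.findGreatest P (5 ^ Module.finrank ℝ E)) :=
    Nat.findGreatest_spec (P := P) (Nat.zero_le _) hP0
  refine ⟨s, hcard s hs, hs.1, fun u hu => ?_⟩
  by_contra! hcon
  have hus : u ∉ s := fun h => by
    have := hcon u h
    norm_num at this
  have hgood : good (insert u s) := by
    refine ⟨?_, ?_⟩
    · intro c hc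
      rcases Finset.mem_insert.1 hc with rfl | hc
      exacts [hu, hs.1 c hc]
    · intro c hc d hd hcd
      rcases Finset.mem_insert.1 hc with rfl | hc' <;> rcases Finset.mem_insert.1 hd with rfl | hd'
      · exact absurd rfl hcd
      · exact (hcon d hd').le
      · rw [norm_sub_rev]; exact (hcon c hc').le
      · exact hs.2 c hc' d hd' hcd
  have := Nat.le_findGreatest (P := P) (hcard _ hgood) ⟨_, hgood, rfl⟩
  rw [Finset.card_insert_of_notMem hus] at this
  omega

/-- Approximating the direction of `T q` by a net point gives `‖T q‖ ≤ 2 * t` on the net;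
approximating the argument then gives `‖T‖ ≤ 2 * t + ‖T‖ / 2`. -/
theorem opNorm_le_of_half_net {E : Type*} [NormedAddCommGroup E] [InnerProductSpace ℝ E]
    {s : Finset E} (hs : ∀ u : E, ‖u‖ ≤ 1 → ∃ c ∈ s, ‖u - c‖ ≤ 1 / 2) (T : E →L[ℝ] E) {t : ℝ}
    (ht : 0 ≤ t) (h : ∀ p ∈ s, ∀ q ∈ s, ⟪p, T q⟫ ≤ t) : ‖T‖ ≤ 4 * t := by
  have hT (q : E) (hq : q ∈ s) : ‖T q‖ ≤ 2 * t := by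
    by_cases h0 : T q = 0
    · rw [h0, norm_zero]; positivity
    have hpos : 0 < ‖T q‖ := norm_pos_iff.2 h0
    obtain ⟨p, hp, hup⟩ := hs (‖T q‖⁻¹ • T q) (by
      rw [norm_smul, norm_inv, norm_norm, inv_mul_cancel₀ hpos.ne'])
    have h1 : ⟪‖T q‖⁻¹ • T q, T q⟫ = ‖T q‖ := by
      rw [real_inner_smul_left, real_inner_self_eq_norm_sq]; field_simp
    have h2 : ⟪‖T q‖⁻¹ • T q - p, T q⟫ ≤ 1 / 2 * ‖T q‖ :=
      (real_inner_le_norm _ _).trans (by gcongr)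
    rw [inner_sub_left, h1] at h2
    linarith [h p hp q hq]
  suffices hmain : ‖T‖ ≤ 2 * t + ‖T‖ / 2 by linarith
  refine T.opNorm_le_of_unit_norm (by positivity) fun u hu => ?_
  obtain ⟨q, hq, huq⟩ := hs u hu.le
  calc ‖T u‖ = ‖T q + T (u - q)‖ := by rw [← map_add]; simp
    _ ≤ ‖T q‖ + ‖T (u - q)‖ := norm_add_le _ _
    _ ≤ 2 * t + ‖T‖ * (1 / 2) := by
      gcongr
      · exact hT q hq
      · exact T.le_of_opNorm_le_of_le le_rfl huq
    _ = _ := by ring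

/-! ### The centred adjacency matrix -/

/-- The centred adjacency matrix: the off-diagonal part of `A - x xᵀ`. -/
def centeredAdj {n : ℕ} (x : Fin n → ℝ) (A : Matrix (Fin n) (Fin n) ℝ) :
    Matrix (Fin n) (Fin n) ℝ :=
  Matrix.of fun i j => if i = j then 0 else A i j - x i * x j

theorem centeredAdj_isSymm {n : ℕ} (x : Fin n → ℝ) {A : Matrix (Fin n) (Fin n) ℝ}
    (hA : A.IsSymm) : (centeredAdj x A).IsSymm := by
  ext i j
  simp only [transpose_apply, centeredAdj, of_apply, eq_comm (a := i), hA.apply i j,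
    mul_comm (x i)]

/-- Only the entries above the diagonal are independent, so bilinear forms are folded onto the pairs
`i < j`. -/
theorem dotProduct_mulVec_eq_sum_Ioi {n : ℕ} {M : Matrix (Fin n) (Fin n) ℝ} (hM : M.IsSymm)
    (h0 : ∀ i, M i i = 0) (u v : Fin n → ℝ) :
    u ⬝ᵥ M *ᵥ v = ∑ i, ∑ j ∈ Finset.Ioi i, (u i * v j + u j * v i) * M i j := by
  have h1 : u ⬝ᵥ M *ᵥ v = ∑ i, ∑ j ∈ {i}ᶜ, u j * v i * M j i := by
    simp only [dotProduct, mulVec, Finset.mul_sum]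
    rw [Finset.sum_comm]
    refine Finset.sum_congr rfl fun i _ => ?_
    rw [← Finset.sum_compl_add_sum {i}]
    simp only [Finset.sum_singleton, h0, zero_mul, mul_zero, add_zero]
    exact Finset.sum_congr rfl fun j _ => by ring
  rw [h1, ← Finset.sum_sum_Ioi_add_eq_sum_sum_off_diag (fun j i => u j * v i * M j i)]
  refine Finset.sum_congr rfl fun i _ => Finset.sum_congr rfl fun j _ => ?_
  rw [hM.apply i j]; ring

theorem dotProduct_centeredAdj_mulVec {n : ℕ} (x : Fin n → ℝ) {A : Matrix (Fin n) (Fin n) ℝ}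
    (hA : A.IsSymm) (u v : Fin n → ℝ) :
    u ⬝ᵥ centeredAdj x A *ᵥ v =
      ∑ i, ∑ j ∈ Finset.Ioi i, (u i * v j + u j * v i) * (A i j - x i * x j) := by
  rw [dotProduct_mulVec_eq_sum_Ioi (centeredAdj_isSymm x hA) (by simp [centeredAdj])]
  refine Finset.sum_congr rfl fun i _ => Finset.sum_congr rfl fun j hj => ?_
  simp [centeredAdj, (Finset.mem_Ioi.1 hj).ne]

theorem sum_Ioi_sq_le {n : ℕ} (u v : Fin n → ℝ) :
    ∑ i, ∑ j ∈ Finset.Ioi i, (u i * v j + u j * v i) ^ 2 ≤ 2 * ((u ⬝ᵥ u) * (v ⬝ᵥ v)) := by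
  calc ∑ i, ∑ j ∈ Finset.Ioi i, (u i * v j + u j * v i) ^ 2
      ≤ ∑ i, ∑ j ∈ Finset.Ioi i, 2 * ((u j * v i) ^ 2 + (u i * v j) ^ 2) := by
        gcongr with i _ j _
        nlinarith [sq_nonneg (u i * v j - u j * v i)]
    _ = 2 * ∑ i, ∑ j ∈ {i}ᶜ, (u j * v i) ^ 2 := by
        simp only [← Finset.mul_sum]
        rw [Finset.sum_sum_Ioi_add_eq_sum_sum_off_diag (fun j i => (u j * v i) ^ 2)]
    _ ≤ 2 * ∑ i, ∑ j, (u j * v i) ^ 2 := by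
        refine mul_le_mul_of_nonneg_left (Finset.sum_le_sum fun i _ => ?_) zero_le_two
        exact Finset.sum_le_sum_of_subset_of_nonneg (Finset.subset_univ _)
          fun _ _ _ => sq_nonneg _
    _ = _ := by
        rw [Finset.sum_comm]
        simp only [dotProduct, Finset.sum_mul_sum]
        congr 1
        exact Finset.sum_congr rfl fun i _ => Finset.sum_congr rfl fun j _ => by ring

theorem dotProduct_mulVec_eq_of_hollow {n : ℕ} (x : Fin n → ℝ) {A : Matrix (Fin n) (Fin n) ℝ}
    (h0 : ∀ i, A i i = 0) (u : Fin n → ℝ) :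
    u ⬝ᵥ A *ᵥ u = (x ⬝ᵥ u) ^ 2 - ∑ i, (x i * u i) ^ 2 + u ⬝ᵥ centeredAdj x A *ᵥ u := by
  have hA : A = vecMulVec x x - diagonal (fun i => x i ^ 2) + centeredAdj x A := by
    ext i j
    by_cases h : i = j
    · subst h
      simp [centeredAdj, vecMulVec_apply, h0, sq]
    · simp [centeredAdj, vecMulVec_apply, h]
  conv_lhs => rw [hA]
  rw [add_mulVec, sub_mulVec, dotProduct_add, dotProduct_sub, vecMulVec_mulVec]
  congr 2
  · simp [dotProduct_comm u x, sq]
  · simp only [dotProduct, mulVec_diagonal]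
    exact Finset.sum_congr rfl fun i _ => by ring

/-- In the upper bound the diagonal correction has a favourable sign and is dropped. In the lower
bound, with test vector `x`, it is `∑ x i ^ 4 ≤ ‖x‖²`, which costs `1` after division by `‖x‖²`. -/
theorem abs_topEigenvalue_sub_le {n : ℕ} {x : Fin n → ℝ} {A : Matrix (Fin n) (Fin n) ℝ}
    (hx : ∀ i, x i ∈ Set.Icc (0 : ℝ) 1) (hA : A.IsSymm) (h0 : ∀ i, A i i = 0) {t B : ℝ}
    (hpos : 0 < l2norm x ^ 2)
    (ht : |x ⬝ᵥ centeredAdj x A *ᵥ x| ≤ t * l2norm x ^ 2)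
    (hB : ‖toEuclideanCLM (n := Fin n) (𝕜 := ℝ) (centeredAdj x A)‖ ≤ B) :
    |topEigenvalue A - l2norm x ^ 2| ≤ 1 + t + 2 * B ^ 2 / l2norm x ^ 2 := by
  set r := l2norm x ^ 2 with hr
  have hxx : x ⬝ᵥ x = r := (l2norm_sq x).symm
  set W := centeredAdj x A with hW
  set T := toEuclideanCLM (n := Fin n) (𝕜 := ℝ) W with hT
  have ht0 : 0 ≤ t := by
    by_contra! h
    nlinarith [abs_nonneg (x ⬝ᵥ W *ᵥ x)]
  have hq : 0 ≤ 2 * B ^ 2 / r := by positivity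
  have hup : topEigenvalue A ≤ r + t + 2 * B ^ 2 / r := by
    refine topEigenvalue_le (by positivity) fun u hu => ?_
    have hsymm : (T : EuclideanSpace ℝ (Fin n) →ₗ[ℝ] EuclideanSpace ℝ (Fin n)).IsSymmetric := by
      intro y z
      change ⟪T y, z⟫ = ⟪y, T z⟫
      rw [real_inner_comm, inner_toEuclideanCLM, inner_toEuclideanCLM, dotProduct_mulVec,
        dotProduct_comm, ← mulVec_transpose, (centeredAdj_isSymm x hA).eq]
    have hu1 : ‖WithLp.toLp 2 u‖ = 1 := by
      have : l2norm u ^ 2 = 1 := by rw [l2norm_sq, hu]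
      exact (pow_eq_one_iff_of_nonneg (norm_nonneg _) two_ne_zero).1 this
    have hx0 : WithLp.toLp 2 x ≠ 0 := by
      intro h
      rw [hr, l2norm, h] at hpos
      simp at hpos
    have := inner_sq_add_inner_le hsymm hx0 hu1
    rw [inner_toEuclideanCLM, inner_toEuclideanCLM, EuclideanSpace.inner_toLp_toLp] at this
    simp only [star_trivial, dotProduct_comm u x] at this
    change _ ≤ r + _ / r + _ / r at this
    rw [dotProduct_mulVec_eq_of_hollow x h0 u]
    have h1 : 0 ≤ ∑ i, (x i * u i) ^ 2 := Finset.sum_nonneg fun i _ => sq_nonneg _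
    have h2 : |x ⬝ᵥ W *ᵥ x| / r ≤ t := by rwa [div_le_iff₀ hpos]
    have h3 : 2 * ‖T‖ ^ 2 / r ≤ 2 * B ^ 2 / r := by gcongr
    linarith
  have hlow : r - 1 - t ≤ topEigenvalue A := by
    have := dotProduct_mulVec_le_topEigenvalue hA x
    rw [dotProduct_mulVec_eq_of_hollow x h0 x, hxx] at this
    have h1 : ∑ i, (x i * x i) ^ 2 ≤ r := by
      rw [← hxx, dotProduct]
      refine Finset.sum_le_sum fun i _ => ?_
      have h0 := (hx i).1
      have h1 := (hx i).2
      have : x i * x i ≤ 1 := by nlinarith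
      nlinarith [mul_nonneg h0 h0]
    have h2 := (abs_le.1 ht).1
    by_contra! h
    nlinarith
  rw [abs_le]
  constructor <;> linarith

theorem l2norm_sq_le {n : ℕ} {x : Fin n → ℝ} (hx : ∀ i, x i ∈ Set.Icc (0 : ℝ) 1) :
    l2norm x ^ 2 ≤ n := by
  rw [l2norm_sq, dotProduct]
  calc ∑ i, x i * x i ≤ ∑ _i : Fin n, (1 : ℝ) := by
        refine Finset.sum_le_sum fun i _ => ?_
        nlinarith [(hx i).1, (hx i).2]
    _ = n := by simp

/-- Both quantities lie in `[0, n]`; the zero diagonal makes the top eigenvalue nonnegative. This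
handles the regime where `n` is small compared with `log(n/η)/δ²`. -/
theorem abs_topEigenvalue_sub_le_card {n : ℕ} (hn : 1 ≤ n) {x : Fin n → ℝ}
    {A : Matrix (Fin n) (Fin n) ℝ}
    (hx : ∀ i, x i ∈ Set.Icc (0 : ℝ) 1) (hA : A.IsSymm) (h0 : ∀ i, A i i = 0)
    (h01 : ∀ i j, A i j = 0 ∨ A i j = 1) :
    |topEigenvalue A - l2norm x ^ 2| ≤ n := by
  have h1 := l2norm_sq_le hx
  have h2 : 0 ≤ l2norm x ^ 2 := sq_nonneg _
  have hup : topEigenvalue A ≤ n := by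
    refine topEigenvalue_le (by positivity) fun u hu => ?_
    calc u ⬝ᵥ A *ᵥ u ≤ ∑ i, ∑ j, (u i ^ 2 + u j ^ 2) / 2 := by
          simp only [dotProduct, mulVec, Finset.mul_sum]
          refine Finset.sum_le_sum fun i _ => Finset.sum_le_sum fun j _ => ?_
          rcases h01 i j with h | h <;> rw [h]
          · nlinarith [sq_nonneg (u i), sq_nonneg (u j)]
          · nlinarith [sq_nonneg (u i - u j)]
      _ = n * (u ⬝ᵥ u) := by
          simp only [← Finset.sum_div, Finset.sum_add_distrib, dotProduct, ← sq]
          simp only [Finset.sum_const, Finset.card_univ, Fintype.card_fin, nsmul_eq_mul,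
            ← Finset.mul_sum]
          ring
      _ = n := by rw [hu, mul_one]
  have hlow : 0 ≤ topEigenvalue A := by
    have := dotProduct_mulVec_le_topEigenvalue hA (Pi.single ⟨0, hn⟩ 1)
    simpa [h0] using this
  rw [abs_le]
  constructor <;> linarith

/-! ### Exponential moments of the conditionally independent edges -/

/-- Hoeffding's lemma applied to the two-point law on `{0, 1}`. -/
theorem bernoulli_exp_moment_le {p : ℝ} (hp : p ∈ Set.Icc (0 : ℝ) 1) (c : ℝ) :
    p * Real.exp (c * (1 - p)) + (1 - p) * Real.exp (c * (0 - p)) ≤ Real.exp (c ^ 2 / 8) := by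
  have hp0 := hp.1
  have hp1 : 0 ≤ 1 - p := sub_nonneg.2 hp.2
  let ν : Measure ℝ := ENNReal.ofReal p • Measure.dirac 1 + ENNReal.ofReal (1 - p) • Measure.dirac 0
  have hprob : IsProbabilityMeasure ν := ⟨by
    simp only [ν, Measure.add_apply, Measure.smul_apply, measure_univ, smul_eq_mul, mul_one]
    rw [← ENNReal.ofReal_add hp0 hp1]; simp⟩
  have hint (f : ℝ → ℝ) : ∫ x, f x ∂ν = p * f 1 + (1 - p) * f 0 := by
    have hi (q y : ℝ) : Integrable f (ENNReal.ofReal q • Measure.dirac y) :=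
      (integrable_dirac (by simp)).smul_measure ENNReal.ofReal_ne_top
    rw [integral_add_measure (hi _ _) (hi _ _), integral_smul_measure, integral_smul_measure,
      integral_dirac, integral_dirac, ENNReal.toReal_ofReal hp0, ENNReal.toReal_ofReal hp1]
    simp
  have hmem : ∀ᵐ x ∂ν, id x ∈ Set.Icc (0 : ℝ) 1 := by
    rw [ae_add_measure_iff]
    constructor <;> refine Measure.ae_smul_measure ?_ _ <;>
      exact (ae_dirac_iff measurableSet_Icc).2 (by simp)
  have h := (hasSubgaussianMGF_of_mem_Icc (μ := ν) aemeasurable_id hmem).mgf_le c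
  rw [mgf, hint, hint] at h
  simp only [id, mul_one, mul_zero, add_zero] at h
  convert h using 2
  simp; ring

/-- Distributivity. Coordinates with `j ≤ i` are frozen at `false`, so that each upper-triangular
pattern is counted once. -/
theorem sum_strict_upper_prod {n : ℕ} (f : Fin n → Fin n → Bool → ℝ) :
    ∑ a ∈ Fintype.piFinset fun i : Fin n => Fintype.piFinset fun j : Fin n =>
        if i < j then (Finset.univ : Finset Bool) else {false},
      ∏ i, ∏ j ∈ Finset.Ioi i, f i j (a i j) =
    ∏ i, ∏ j ∈ Finset.Ioi i, (f i j true + f i j false) := by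
  have hIoi (i : Fin n) (g : Fin n → ℝ) :
      ∏ j ∈ Finset.Ioi i, g j = ∏ j, if i < j then g j else 1 := by
    rw [← Finset.prod_filter, ← Finset.filter_lt_eq_Ioi]
  simp only [hIoi]
  rw [← Finset.prod_univ_sum (fun i : Fin n => Fintype.piFinset fun j : Fin n =>
        if i < j then (Finset.univ : Finset Bool) else {false})
        (fun i b => ∏ j, if i < j then f i j (b j) else 1)]
  refine Finset.prod_congr rfl fun i _ => ?_
  rw [← Finset.prod_univ_sum (fun j : Fin n =>
        if i < j then (Finset.univ : Finset Bool) else {false})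
        (fun j b => if i < j then f i j b else 1)]
  refine Finset.prod_congr rfl fun j _ => ?_
  by_cases h : i < j <;> simp [h]

namespace IsRDPG

variable {F : Measure ℝ} {n : ℕ} {Ω : Type*} [MeasurableSpace Ω] {μ : Measure Ω}
  {X : Ω → Fin n → ℝ} {A : Ω → Matrix (Fin n) (Fin n) ℝ}

theorem measurable_X_apply (h : IsRDPG F n μ X A) (i : Fin n) : Measurable fun ω => X ω i :=
  (measurable_pi_apply i).comp h.measurable_X

theorem ae_mem_Icc (h : IsRDPG F n μ X A) (hF : ∀ᵐ x ∂F, x ∈ Set.Icc (0 : ℝ) 1) :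
    ∀ᵐ ω ∂μ, ∀ i, X ω i ∈ Set.Icc (0 : ℝ) 1 := by
  rw [ae_all_iff]
  intro i
  rw [← h.law_X i] at hF
  exact ae_of_ae_map (h.measurable_X_apply i).aemeasurable hF

theorem measurableSet_pattern (h : IsRDPG F n μ X A) (a : Fin n → Fin n → Bool) :
    MeasurableSet {ω | ∀ i j, i < j → A ω i j = if a i j then 1 else 0} := by
  simp only [Set.ofPred_forall]
  refine MeasurableSet.iInter fun i => MeasurableSet.iInter fun j => MeasurableSet.iInter fun _ => ?_
  exact h.measurable_A i j (measurableSet_singleton _)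

/-- The factor `g (X ω)` is known given `X`, so it comes out of the conditional expectation of the
indicator. -/
theorem integral_indicator_pattern [IsProbabilityMeasure μ] (h : IsRDPG F n μ X A)
    (a : Fin n → Fin n → Bool) {g : (Fin n → ℝ) → ℝ} (hg : Measurable g) {b : ℝ}
    (hb : ∀ᵐ ω ∂μ, ‖g (X ω)‖ ≤ b) :
    Integrable (fun ω => g (X ω) * ∏ i, ∏ j ∈ Finset.Ioi i,
        (if a i j then X ω i * X ω j else 1 - X ω i * X ω j)) μ ∧
    ∫ ω, {ω | ∀ i j, i < j → A ω i j = if a i j then 1 else 0}.indicator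
        (fun ω => g (X ω)) ω ∂μ =
      ∫ ω, g (X ω) * ∏ i, ∏ j ∈ Finset.Ioi i,
        (if a i j then X ω i * X ω j else 1 - X ω i * X ω j) ∂μ := by
  set S := {ω | ∀ i j, i < j → A ω i j = if a i j then 1 else 0} with hS
  have hSm : MeasurableSet S := h.measurableSet_pattern a
  have hle : MeasurableSpace.comap X inferInstance ≤ (inferInstance : MeasurableSpace Ω) :=
    h.measurable_X.comap_le
  have hgX : StronglyMeasurable[MeasurableSpace.comap X inferInstance] fun ω => g (X ω) :=
    (hg.comp (comap_measurable X)).stronglyMeasurable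
  have hpull := condExp_stronglyMeasurable_mul_of_bound (μ := μ) hle hgX
    ((integrable_const (1 : ℝ)).indicator hSm) b hb
  have hcond := h.cond_A a
  rw [← hS] at hcond
  have hprod : μ[(fun ω => g (X ω)) * S.indicator (fun _ => (1 : ℝ)) |
      MeasurableSpace.comap X inferInstance] =ᵐ[μ] fun ω => g (X ω) * ∏ i, ∏ j ∈ Finset.Ioi i,
        (if a i j then X ω i * X ω j else 1 - X ω i * X ω j) := by
    filter_upwards [hpull, hcond] with ω h1 h2
    rw [h1, Pi.mul_apply, h2]
  refine ⟨integrable_condExp.congr hprod, ?_⟩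
  rw [← integral_congr_ae hprod, integral_condExp hle]
  refine integral_congr_ae (.of_forall fun ω => ?_)
  by_cases hω : ω ∈ S <;> simp [hω]

end IsRDPG

namespace IsRDPG

variable {F : Measure ℝ} {n : ℕ} {Ω : Type*} [MeasurableSpace Ω] {μ : Measure Ω}
  {X : Ω → Fin n → ℝ} {A : Ω → Matrix (Fin n) (Fin n) ℝ}

/-- The conditional law is known through probabilities of whole patterns, so the integral is split
by pattern; on each one the edges are constants. Summing back, the weighted sum factors over edges
into Bernoulli exponential moments. The weights `c` may depend on `X`, as the quadratic form in `X`
requires. -/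
theorem integral_exp_le [IsProbabilityMeasure μ] (h : IsRDPG F n μ X A)
    (hF : ∀ᵐ x ∂F, x ∈ Set.Icc (0 : ℝ) 1) {c : (Fin n → ℝ) → Fin n → Fin n → ℝ}
    (hc : ∀ i j, Measurable fun x => c x i j) {K : ℝ}
    (hK : ∀ x, ∑ i, ∑ j ∈ Finset.Ioi i, c x i j ^ 2 ≤ K) :
    Integrable (fun ω => Real.exp (∑ i, ∑ j ∈ Finset.Ioi i,
      c (X ω) i j * (A ω i j - X ω i * X ω j))) μ ∧
    ∫ ω, Real.exp (∑ i, ∑ j ∈ Finset.Ioi i, c (X ω) i j * (A ω i j - X ω i * X ω j)) ∂μ ≤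
      Real.exp (K / 8) := by
  classical
  set P : Finset (Fin n → Fin n → Bool) :=
    Fintype.piFinset fun i : Fin n => Fintype.piFinset fun j : Fin n =>
      if i < j then (Finset.univ : Finset Bool) else {false} with hP
  let G (a : Fin n → Fin n → Bool) (x : Fin n → ℝ) : ℝ :=
    Real.exp (∑ i, ∑ j ∈ Finset.Ioi i, c x i j * ((if a i j then 1 else 0) - x i * x j))
  have hGm (a) : Measurable (G a) := by
    refine Real.measurable_exp.comp ?_
    refine Finset.measurable_sum _ fun i _ => Finset.measurable_sum _ fun j _ => ?_
    exact (hc i j).mul (measurable_const.sub ((measurable_pi_apply i).mul (measurable_pi_apply j)))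
  have hXmem := h.ae_mem_Icc hF
  have hp {x : Fin n → ℝ} (hx : ∀ i, x i ∈ Set.Icc (0 : ℝ) 1) (i j) :
      x i * x j ∈ Set.Icc (0 : ℝ) 1 :=
    ⟨mul_nonneg (hx i).1 (hx j).1, mul_le_one₀ (hx i).2 (hx j).1 (hx j).2⟩
  -- A crude bound, needed only for integrability: `c * y ≤ c ^ 2 + 1` for each edge when `|y| ≤ 1`.
  set b := Real.exp (K + ∑ i : Fin n, ∑ j ∈ Finset.Ioi i, (1 : ℝ)) with hb
  have hGb (a) : ∀ᵐ ω ∂μ, ‖G a (X ω)‖ ≤ b := by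
    filter_upwards [hXmem] with ω hω
    rw [Real.norm_eq_abs, Real.abs_exp, hb, Real.exp_le_exp]
    refine le_trans ?_ (add_le_add_left (hK (X ω)) _)
    rw [← Finset.sum_add_distrib]
    refine Finset.sum_le_sum fun i _ => ?_
    rw [← Finset.sum_add_distrib]
    refine Finset.sum_le_sum fun j _ => ?_
    obtain ⟨h0, h1⟩ := hp hω i j
    have hy : ((if a i j then 1 else 0) - X ω i * X ω j) ^ 2 ≤ 1 := by
      split_ifs <;> nlinarith
    nlinarith [sq_nonneg (c (X ω) i j - ((if a i j then 1 else 0) - X ω i * X ω j)),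
      sq_nonneg (c (X ω) i j)]
  let S (a : Fin n → Fin n → Bool) : Set Ω :=
    {ω | ∀ i j, i < j → A ω i j = if a i j then 1 else 0}
  have hdecomp (ω : Ω) : Real.exp (∑ i, ∑ j ∈ Finset.Ioi i,
      c (X ω) i j * (A ω i j - X ω i * X ω j)) =
      ∑ a ∈ P, (S a).indicator (fun ω => G a (X ω)) ω := by
    let a₀ : Fin n → Fin n → Bool := fun i j => decide (i < j ∧ A ω i j = 1)
    have ha₀ : ω ∈ S a₀ := by
      intro i j hij
      rcases h.zero_one_A ω i j with h0 | h0 <;> simp [a₀, hij, h0]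
    rw [Finset.sum_eq_single a₀]
    · rw [Set.indicator_of_mem ha₀]
      refine congrArg Real.exp (Finset.sum_congr rfl fun i _ => Finset.sum_congr rfl fun j hj => ?_)
      rw [ha₀ i j (Finset.mem_Ioi.1 hj)]
    · intro a ha hne
      refine Set.indicator_of_notMem (fun hω => hne ?_) _
      funext i j
      by_cases hij : i < j
      · have h1 := hω i j hij
        have h2 := ha₀ i j hij
        rw [h1] at h2
        cases ha : a i j <;> cases hb : a₀ i j <;> simp_all
      · have := Fintype.mem_piFinset.1 (Fintype.mem_piFinset.1 ha i) j
        rw [if_neg hij, Finset.mem_singleton] at this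
        simp [this, a₀, hij]
    · intro hn
      refine absurd ?_ hn
      rw [hP, Fintype.mem_piFinset]
      intro i
      rw [Fintype.mem_piFinset]
      intro j
      by_cases hij : i < j <;> simp [hij, a₀, em]
  have hGi (a) : Integrable (fun ω => G a (X ω)) μ :=
    Integrable.of_bound ((hGm a).comp h.measurable_X).aestronglyMeasurable b (hGb a)
  have hSi (a) : Integrable ((S a).indicator fun ω => G a (X ω)) μ :=
    (hGi a).indicator (h.measurableSet_pattern a)
  simp only [hdecomp]
  refine ⟨integrable_finsetSum _ fun a _ => hSi a, ?_⟩
  rw [integral_finsetSum _ fun a _ => hSi a]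
  have hpat (a) := h.integral_indicator_pattern a (hGm a) (hGb a)
  rw [Finset.sum_congr rfl fun a _ => (hpat a).2, ← integral_finsetSum _ fun a _ => (hpat a).1]
  have hbound : ∀ᵐ ω ∂μ, ∑ a ∈ P, G a (X ω) * ∏ i, ∏ j ∈ Finset.Ioi i,
      (if a i j then X ω i * X ω j else 1 - X ω i * X ω j) ≤ Real.exp (K / 8) := by
    filter_upwards [hXmem] with ω hω
    let f (i j : Fin n) (β : Bool) : ℝ :=
      Real.exp (c (X ω) i j * ((if β then 1 else 0) - X ω i * X ω j)) *
        (if β then X ω i * X ω j else 1 - X ω i * X ω j)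
    have hGf (a : Fin n → Fin n → Bool) : G a (X ω) * ∏ i, ∏ j ∈ Finset.Ioi i,
        (if a i j then X ω i * X ω j else 1 - X ω i * X ω j) =
        ∏ i, ∏ j ∈ Finset.Ioi i, f i j (a i j) := by
      simp only [G, f, Real.exp_sum, Finset.prod_mul_distrib]
    simp only [hGf]
    rw [sum_strict_upper_prod]
    calc ∏ i, ∏ j ∈ Finset.Ioi i, (f i j true + f i j false)
        ≤ ∏ i, ∏ j ∈ Finset.Ioi i, Real.exp (c (X ω) i j ^ 2 / 8) := by
          have hpos (i j : Fin n) : 0 ≤ f i j true + f i j false := by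
            obtain ⟨h0, h1⟩ := hp hω i j
            have h1' : 0 ≤ 1 - X ω i * X ω j := sub_nonneg.2 h1
            simp only [f, if_true, Bool.false_eq_true, if_false]
            positivity
          refine Finset.prod_le_prod (fun i _ => Finset.prod_nonneg fun j _ => hpos i j)
            fun i _ => Finset.prod_le_prod (fun j _ => hpos i j) fun j _ => ?_
          have := bernoulli_exp_moment_le (hp hω i j) (c (X ω) i j)
          simp only [f, if_true, Bool.false_eq_true, if_false]
          linarith
      _ = Real.exp ((∑ i, ∑ j ∈ Finset.Ioi i, c (X ω) i j ^ 2) / 8) := by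
          simp only [Finset.sum_div, Real.exp_sum]
      _ ≤ Real.exp (K / 8) := by
          have := hK (X ω)
          gcongr
  calc _ ≤ ∫ _ω, Real.exp (K / 8) ∂μ :=
        integral_mono_ae (integrable_finsetSum _ fun a _ => (hpat a).1) (integrable_const _) hbound
    _ = _ := by simp

/-- Conditional Hoeffding bound for a weighted sum of the centred edges. -/
theorem measureReal_sum_ge_le [IsProbabilityMeasure μ] (h : IsRDPG F n μ X A)
    (hF : ∀ᵐ x ∂F, x ∈ Set.Icc (0 : ℝ) 1) {c : (Fin n → ℝ) → Fin n → Fin n → ℝ}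
    (hc : ∀ i j, Measurable fun x => c x i j)
    (hK : ∀ x, ∑ i, ∑ j ∈ Finset.Ioi i, c x i j ^ 2 ≤ 2) {t : ℝ} (ht : 0 ≤ t) :
    μ.real {ω | t ≤ ∑ i, ∑ j ∈ Finset.Ioi i, c (X ω) i j * (A ω i j - X ω i * X ω j)} ≤
      Real.exp (-t ^ 2) := by
  -- The Chernoff parameter `s = 2 * t` minimises `-s * t + s ^ 2 * 2 / 8`, with minimum `-t ^ 2`.
  have hexp := h.integral_exp_le hF (c := fun x i j => 2 * t * c x i j)
    (fun i j => (hc i j).const_mul _) (K := (2 * t) ^ 2 * 2) (fun x => by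
      simp only [mul_pow, ← Finset.mul_sum]
      have := hK x
      simp only [← mul_pow] at *
      gcongr)
  have hmul (ω) : ∑ i, ∑ j ∈ Finset.Ioi i, 2 * t * c (X ω) i j * (A ω i j - X ω i * X ω j) =
      2 * t * ∑ i, ∑ j ∈ Finset.Ioi i, c (X ω) i j * (A ω i j - X ω i * X ω j) := by
    simp only [Finset.mul_sum, mul_assoc]
  simp only [hmul] at hexp
  have := measure_ge_le_exp_mul_mgf t (by positivity : 0 ≤ 2 * t) hexp.1
  refine this.trans ?_
  calc _ ≤ Real.exp (-(2 * t) * t) * Real.exp ((2 * t) ^ 2 * 2 / 8) := by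
        gcongr
        exact hexp.2
    _ = _ := by rw [← Real.exp_add]; congr 1; ring

end IsRDPG

/-! ### Tail bounds for the norm, the quadratic form and the noise; concentration of the top
eigenvalue -/

theorem secondMoment_le_one {F : Measure ℝ} [IsProbabilityMeasure F]
    (hF : ∀ᵐ x ∂F, x ∈ Set.Icc (0 : ℝ) 1) : secondMoment F ≤ 1 := by
  have hsq : ∀ᵐ x ∂F, x ^ 2 ∈ Set.Icc (0 : ℝ) 1 := by
    filter_upwards [hF] with x hx
    exact ⟨sq_nonneg x, pow_le_one₀ hx.1 hx.2⟩
  calc secondMoment F ≤ ∫ _x, (1 : ℝ) ∂F :=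
        integral_mono_ae (Integrable.of_mem_Icc 0 1 (by fun_prop) hsq) (integrable_const _)
          (hsq.mono fun x hx => hx.2)
    _ = 1 := by simp

namespace IsRDPG

variable {F : Measure ℝ} {n : ℕ} {Ω : Type*} [MeasurableSpace Ω] {μ : Measure Ω}
  [IsProbabilityMeasure μ] {X : Ω → Fin n → ℝ} {A : Ω → Matrix (Fin n) (Fin n) ℝ}

/-- Hoeffding for the independent variables `-(X i ^ 2) ∈ [-1, 0]`, at deviation `n * δ / 2` from
the mean. -/
theorem measureReal_l2norm_sq_le (h : IsRDPG F n μ X A) (hF : ∀ᵐ x ∂F, x ∈ Set.Icc (0 : ℝ) 1)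
    (hδ : 0 < secondMoment F) (hn : 1 ≤ n) :
    μ.real {ω | l2norm (X ω) ^ 2 ≤ n * secondMoment F / 2} ≤
      Real.exp (-(n * secondMoment F ^ 2 / 2)) := by
  set δ := secondMoment F with hδdef
  have hmean (i : Fin n) : ∫ ω, -(X ω i ^ 2) ∂μ = -δ := by
    rw [integral_neg, hδdef, secondMoment, ← h.law_X i,
      integral_map (h.measurable_X_apply i).aemeasurable (by fun_prop)]
  have hsub (i : Fin n) : HasSubgaussianMGF (fun ω => -(X ω i ^ 2) + δ)
      ((‖(0 : ℝ) - (-1)‖₊ / 2) ^ 2) μ := by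
    have hm : AEMeasurable (fun ω => -(X ω i ^ 2)) μ :=
      ((h.measurable_X_apply i).pow_const 2).neg.aemeasurable
    have := hasSubgaussianMGF_of_mem_Icc (a := -1) (b := 0) hm (by
      filter_upwards [h.ae_mem_Icc hF] with ω hω
      have h0 := (hω i).1
      have h1 := (hω i).2
      constructor <;> nlinarith)
    simpa only [hmean, sub_neg_eq_add] using this
  have hindep : iIndepFun (fun i ω => -(X ω i ^ 2) + δ) μ :=
    h.indep_X.comp (fun _ x => -(x ^ 2) + δ) (fun _ => by fun_prop)
  have htail := HasSubgaussianMGF.measure_sum_ge_le_of_iIndepFun hindep (s := Finset.univ)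
    (fun i _ => hsub i) (ε := n * δ / 2) (by positivity)
  have hset : {ω | l2norm (X ω) ^ 2 ≤ n * δ / 2} =
      {ω | n * δ / 2 ≤ ∑ i, (-(X ω i ^ 2) + δ)} := by
    ext ω
    simp only [Set.mem_ofPred_eq, l2norm_sq, dotProduct, Finset.sum_add_distrib,
      Finset.sum_neg_distrib, Finset.sum_const, Finset.card_univ, Fintype.card_fin, nsmul_eq_mul,
      ← sq]
    constructor <;> intro _ <;> linarith
  rw [hset]
  refine htail.trans (le_of_eq ?_)
  congr 1
  have hn0 : (n : ℝ) ≠ 0 := by positivity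
  simp
  field_simp

theorem measureReal_abs_quadratic_gt_le (h : IsRDPG F n μ X A)
    (hF : ∀ᵐ x ∂F, x ∈ Set.Icc (0 : ℝ) 1) {t : ℝ} (ht : 0 ≤ t) :
    μ.real {ω | t * l2norm (X ω) ^ 2 < |X ω ⬝ᵥ centeredAdj (X ω) (A ω) *ᵥ X ω|} ≤
      2 * Real.exp (-t ^ 2) := by
  -- Normalising turns the form into a sum whose weights have squares summing to at most `2`. At `x
  -- = 0` the convention `0⁻¹ = 0` gives `w = 0`, and the strict inequality in the event excludes
  -- that case.
  let w (x : Fin n → ℝ) : Fin n → ℝ := (l2norm x)⁻¹ • x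
  have hwm (i : Fin n) : Measurable fun x => w x i := by
    have : Measurable (l2norm : (Fin n → ℝ) → ℝ) :=
      (PiLp.continuous_toLp 2 _).norm.measurable
    exact this.inv.mul (measurable_pi_apply i)
  let c (x : Fin n → ℝ) (i j : Fin n) : ℝ := w x i * w x j + w x j * w x i
  have hcm (i j : Fin n) : Measurable fun x => c x i j :=
    ((hwm i).mul (hwm j)).add ((hwm j).mul (hwm i))
  have hww (x : Fin n → ℝ) : w x ⬝ᵥ w x ≤ 1 := by
    simp only [w, smul_dotProduct, dotProduct_smul, ← l2norm_sq, smul_eq_mul]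
    by_cases h0 : l2norm x = 0
    · simp [h0]
    · apply le_of_eq; field_simp
  have hcK (x : Fin n → ℝ) : ∑ i, ∑ j ∈ Finset.Ioi i, c x i j ^ 2 ≤ 2 := by
    refine (sum_Ioi_sq_le (w x) (w x)).trans ?_
    have h0 : 0 ≤ w x ⬝ᵥ w x := by rw [← l2norm_sq]; positivity
    nlinarith [hww x]
  have h1 := h.measureReal_sum_ge_le hF hcm hcK ht
  have h2 := h.measureReal_sum_ge_le hF (c := fun x i j => -c x i j) (fun i j => (hcm i j).neg)
    (by simpa using hcK) ht
  have hsum (ω : Ω) : ∑ i, ∑ j ∈ Finset.Ioi i, c (X ω) i j * (A ω i j - X ω i * X ω j) =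
      (X ω ⬝ᵥ centeredAdj (X ω) (A ω) *ᵥ X ω) / l2norm (X ω) ^ 2 := by
    rw [← dotProduct_centeredAdj_mulVec (X ω) (h.symm_A ω) (w (X ω)) (w (X ω))]
    simp only [w, mulVec_smul, smul_dotProduct, dotProduct_smul, smul_eq_mul]
    field_simp
  simp only [neg_mul, Finset.sum_neg_distrib, hsum] at h1 h2
  calc _ ≤ μ.real ({ω | t ≤ (X ω ⬝ᵥ centeredAdj (X ω) (A ω) *ᵥ X ω) / l2norm (X ω) ^ 2} ∪
        {ω | t ≤ -((X ω ⬝ᵥ centeredAdj (X ω) (A ω) *ᵥ X ω) / l2norm (X ω) ^ 2)}) := by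
        refine measureReal_mono ?_
        intro ω hω
        simp only [Set.mem_ofPred_eq] at hω
        have hpos : 0 < l2norm (X ω) ^ 2 := by
          refine lt_of_le_of_ne (sq_nonneg _) fun h0 => ?_
          have hx : X ω = 0 := by
            rw [l2norm_sq] at h0; exact dotProduct_self_eq_zero.1 h0.symm
          simp [hx, l2norm] at hω
        simp only [Set.mem_union, Set.mem_ofPred_eq, ← neg_div, le_div_iff₀ hpos]
        exact le_abs.1 hω.le
    _ ≤ _ := measureReal_union_le _ _
    _ ≤ _ := by linarith

/-- Union bound over the at most `5 ^ n * 5 ^ n` pairs of net points. -/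
theorem measureReal_opNorm_gt_le (h : IsRDPG F n μ X A)
    (hF : ∀ᵐ x ∂F, x ∈ Set.Icc (0 : ℝ) 1) {t : ℝ} (ht : 0 ≤ t) :
    μ.real {ω | 4 * t < ‖toEuclideanCLM (n := Fin n) (𝕜 := ℝ) (centeredAdj (X ω) (A ω))‖} ≤
      25 ^ n * Real.exp (-t ^ 2) := by
  obtain ⟨s, hcard, hs1, hs⟩ := exists_half_net (EuclideanSpace ℝ (Fin n))
  rw [finrank_euclideanSpace_fin] at hcard
  let Bad (z : EuclideanSpace ℝ (Fin n) × EuclideanSpace ℝ (Fin n)) : Set Ω :=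
    {ω | t ≤ z.1.ofLp ⬝ᵥ centeredAdj (X ω) (A ω) *ᵥ z.2.ofLp}
  have hone (p : EuclideanSpace ℝ (Fin n)) (hp : p ∈ s) : p.ofLp ⬝ᵥ p.ofLp ≤ 1 := by
    rw [← l2norm_sq]
    exact pow_le_one₀ (norm_nonneg _) (hs1 p hp)
  have hBad (z) (hz : z ∈ s ×ˢ s) : μ.real (Bad z) ≤ Real.exp (-t ^ 2) := by
    obtain ⟨hp, hq⟩ := Finset.mem_product.1 hz
    have := h.measureReal_sum_ge_le hF
      (c := fun _ i j => z.1.ofLp i * z.2.ofLp j + z.1.ofLp j * z.2.ofLp i)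
      (fun _ _ => measurable_const) (fun _ => (sum_Ioi_sq_le _ _).trans (by
        have h1 := mul_le_one₀ (hone _ hp) (by rw [← l2norm_sq]; positivity) (hone _ hq)
        linarith)) ht
    simpa only [Bad, dotProduct_centeredAdj_mulVec _ (h.symm_A _)] using this
  calc _ ≤ μ.real (⋃ z ∈ s ×ˢ s, Bad z) := by
        refine measureReal_mono ?_ (measure_ne_top _ _)
        intro ω hω
        by_contra hcon
        simp only [Set.mem_iUnion, not_exists] at hcon
        refine absurd (opNorm_le_of_half_net hs _ ht fun p hp q hq => ?_) (not_le.2 hω)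
        rw [inner_toEuclideanCLM]
        exact (not_le.1 (hcon (p, q) (Finset.mem_product.2 ⟨hp, hq⟩))).le
    _ ≤ ∑ z ∈ s ×ˢ s, μ.real (Bad z) := measureReal_biUnion_finset_le _ _
    _ ≤ ∑ _z ∈ s ×ˢ s, Real.exp (-t ^ 2) := Finset.sum_le_sum hBad
    _ = ((s.card * s.card : ℕ) : ℝ) * Real.exp (-t ^ 2) := by
        rw [Finset.sum_const, Finset.card_product, nsmul_eq_mul]
    _ ≤ 25 ^ n * Real.exp (-t ^ 2) := by
        gcongr
        calc ((s.card * s.card : ℕ) : ℝ) ≤ ((5 ^ n * 5 ^ n : ℕ) : ℝ) := by gcongr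
          _ = 25 ^ n := by push_cast; rw [← mul_pow]; norm_num

/-- Concentration of the top eigenvalue around `‖X‖²`. -/
theorem measureReal_compl_abs_sub_le (h : IsRDPG F n μ X A) [IsProbabilityMeasure F]
    (hF : ∀ᵐ x ∂F, x ∈ Set.Icc (0 : ℝ) 1) (hδ : 0 < secondMoment F) (hn : 1 ≤ n) {η : ℝ}
    (hη : 0 < η) (hη2 : η ≤ 1 / 2) :
    μ.real {ω | |topEigenvalue (A ω) - l2norm (X ω) ^ 2| ≤
      648 * Real.log (n / η) / secondMoment F ^ 2}ᶜ ≤ η := by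
  set δ := secondMoment F with hδdef
  have hδ1 : δ ≤ 1 := secondMoment_le_one hF
  have hn1 : (1 : ℝ) ≤ n := by exact_mod_cast hn
  set L := Real.log (n / η) with hL
  have hLη : -Real.log η ≤ L := by
    rw [hL, Real.log_div (by positivity) hη.ne']
    linarith [Real.log_nonneg hn1]
  have hlog2 : Real.log 2 ≤ -Real.log η := by
    rw [← Real.log_inv]
    refine Real.log_le_log two_pos ?_
    rw [le_inv_comm₀ two_pos hη]; linarith
  have hlog2' := Real.log_two_gt_d9
  have hL1 : 1 ≤ 2 * L := by linarith
  have hlog4 : Real.log (4 / η) ≤ 3 * L := by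
    rw [Real.log_div (by norm_num) hη.ne', show (4 : ℝ) = 2 ^ 2 by norm_num, Real.log_pow]
    push_cast; linarith
  have hlog8 : Real.log (8 / η) ≤ 4 * L := by
    rw [Real.log_div (by norm_num) hη.ne', show (8 : ℝ) = 2 ^ 3 by norm_num, Real.log_pow]
    push_cast; linarith
  have hlog4' : 0 ≤ Real.log (4 / η) :=
    Real.log_nonneg (by rw [le_div_iff₀ hη]; linarith)
  have hlog8' : 0 ≤ Real.log (8 / η) :=
    Real.log_nonneg (by rw [le_div_iff₀ hη]; linarith)
  set S := {ω | |topEigenvalue (A ω) - l2norm (X ω) ^ 2| ≤ 648 * L / δ ^ 2} with hS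
  have hmem := h.ae_mem_Icc hF
  -- The threshold makes `log (4 / η) ≤ 3 * L ≤ n * δ ^ 2 / 2` in the second case, so the norm bound
  -- fails with probability at most `η / 4`.
  rcases lt_or_ge (n * δ ^ 2) (6 * L) with hcase | hcase
  · have : μ.real Sᶜ = 0 := by
      rw [measureReal_eq_zero_iff]
      refine hmem.mono fun ω hω => ?_
      have h1 := abs_topEigenvalue_sub_le_card hn hω (h.symm_A ω) (h.hollow_A ω) (h.zero_one_A ω)
      refine h1.trans ?_
      rw [le_div_iff₀ (by positivity)]
      linarith
    rw [this]; exact hη.le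
  -- The term `4 * n` pays for the net, as `25 ≤ exp 4`; the logarithm leaves failure probability `η
  -- / 4`.
  set t := √(4 * n + Real.log (4 / η)) with ht
  set τ := √(Real.log (8 / η)) with hτ
  have ht2 : t ^ 2 = 4 * n + Real.log (4 / η) := Real.sq_sqrt (by positivity)
  have hτ2 : τ ^ 2 = Real.log (8 / η) := Real.sq_sqrt hlog8'
  have hexp4 : Real.exp (-Real.log (4 / η)) = η / 4 := by
    rw [Real.exp_neg, Real.exp_log (by positivity), inv_div]
  have hexp8 : Real.exp (-Real.log (8 / η)) = η / 8 := by
    rw [Real.exp_neg, Real.exp_log (by positivity), inv_div]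
  have hp1 := h.measureReal_l2norm_sq_le hF hδ hn
  have hp2 := h.measureReal_abs_quadratic_gt_le hF (t := τ) (Real.sqrt_nonneg _)
  have hp3 := h.measureReal_opNorm_gt_le hF (t := t) (Real.sqrt_nonneg _)
  have hq1 : Real.exp (-(n * δ ^ 2 / 2)) ≤ η / 4 := by
    rw [← hexp4, Real.exp_le_exp]; linarith
  have hq2 : 2 * Real.exp (-τ ^ 2) = η / 4 := by
    rw [hτ2, hexp8]; ring
  have hq3 : 25 ^ n * Real.exp (-t ^ 2) ≤ η / 4 := by
    have h25 : (25 : ℝ) ^ n ≤ Real.exp (4 * n) := by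
      rw [mul_comm, Real.exp_nat_mul]
      gcongr
      have h1 := Real.exp_one_gt_d9
      calc (25 : ℝ) ≤ 2.7 ^ 4 := by norm_num
        _ ≤ Real.exp 1 ^ 4 := by gcongr; linarith
        _ = Real.exp 4 := by rw [← Real.exp_nat_mul]; norm_num
    calc 25 ^ n * Real.exp (-t ^ 2) ≤ Real.exp (4 * n) * Real.exp (-t ^ 2) := by gcongr
      _ = η / 4 := by rw [← Real.exp_add, ht2, ← hexp4]; congr 1; ring
  set E₁ := {ω | l2norm (X ω) ^ 2 ≤ n * δ / 2} with hE₁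
  set E₂ := {ω | τ * l2norm (X ω) ^ 2 < |X ω ⬝ᵥ centeredAdj (X ω) (A ω) *ᵥ X ω|} with hE₂
  set E₃ := {ω | 4 * t <
    ‖toEuclideanCLM (n := Fin n) (𝕜 := ℝ) (centeredAdj (X ω) (A ω))‖} with hE₃
  have hsub : Sᶜ ≤ᵐ[μ] (E₁ ∪ E₂ ∪ E₃ : Set Ω) := by
    filter_upwards [hmem] with ω hω hωS
    by_contra hcon
    have hcon' : ω ∉ E₁ ∪ E₂ ∪ E₃ := hcon
    simp only [Set.mem_union, not_or] at hcon'
    obtain ⟨⟨h1, h2⟩, h3⟩ := hcon'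
    have h1' : n * δ / 2 < l2norm (X ω) ^ 2 := not_le.1 h1
    have hnδ : 0 < n * δ / 2 := by positivity
    have hdet := abs_topEigenvalue_sub_le hω (h.symm_A ω) (h.hollow_A ω) (hnδ.trans h1')
      (not_lt.1 h2) (not_lt.1 h3)
    refine hωS (hdet.trans ?_)
    have hτ1 : τ ≤ 1 + 4 * L := by nlinarith [sq_nonneg (τ - 1)]
    have hlogn : Real.log (4 / η) ≤ n := by
      have : n * δ ^ 2 ≤ n * 1 := by gcongr; exact pow_le_one₀ hδ.le hδ1
      linarith
    -- Here `t ^ 2 ≤ 5 * n`, and the denominator exceeds `n * δ / 2`.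
    have hsec : 2 * (4 * t) ^ 2 / l2norm (X ω) ^ 2 ≤ 320 / δ := by
      calc 2 * (4 * t) ^ 2 / l2norm (X ω) ^ 2 ≤ 160 * n / (n * δ / 2) := by
            have hnum : 2 * (4 * t) ^ 2 ≤ 160 * n := by linarith [mul_pow 4 t 2]
            gcongr
        _ = 320 / δ := by field_simp; norm_num
    rw [le_div_iff₀ (by positivity)]
    calc (1 + τ + 2 * (4 * t) ^ 2 / l2norm (X ω) ^ 2) * δ ^ 2
        ≤ (2 + 4 * L + 320 / δ) * δ ^ 2 := by
          refine mul_le_mul_of_nonneg_right ?_ (sq_nonneg δ)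
          linarith
      _ = (2 + 4 * L) * δ ^ 2 + 320 * δ := by field_simp
      _ ≤ (2 + 4 * L) * 1 + 320 * 1 := by
          gcongr
          · linarith
          · exact pow_le_one₀ hδ.le hδ1
      -- From `1 ≤ 2 * L`: the constant `322` is at most `644 * L`.
      _ ≤ 648 * L := by linarith
  calc μ.real Sᶜ ≤ μ.real (E₁ ∪ E₂ ∪ E₃) :=
        ENNReal.toReal_mono (measure_ne_top _ _) (measure_mono_ae hsub)
    _ ≤ μ.real (E₁ ∪ E₂) + μ.real E₃ := measureReal_union_le _ _
    _ ≤ μ.real E₁ + μ.real E₂ + μ.real E₃ := by gcongr; exact measureReal_union_le _ _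
    _ ≤ η := by linarith

theorem one_sub_le_measureReal_abs_sub_le (h : IsRDPG F n μ X A) [IsProbabilityMeasure F]
    (hF : ∀ᵐ x ∂F, x ∈ Set.Icc (0 : ℝ) 1) (hδ : 0 < secondMoment F) (hn : 1 ≤ n) {η : ℝ}
    (hη : 0 < η) (hη2 : η ≤ 1 / 2) :
    1 - η ≤ μ.real {ω | |topEigenvalue (A ω) - l2norm (X ω) ^ 2| ≤
      648 * Real.log (n / η) / secondMoment F ^ 2} := by
  have hcompl := h.measureReal_compl_abs_sub_le hF hδ hn hη hη2
  set S := {ω | |topEigenvalue (A ω) - l2norm (X ω) ^ 2| ≤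
    648 * Real.log (n / η) / secondMoment F ^ 2}
  have hunion : μ.real (S ∪ Sᶜ) ≤ μ.real S + μ.real Sᶜ := measureReal_union_le _ _
  rw [Set.union_compl_self, probReal_univ] at hunion
  linarith

end IsRDPG

/-! ### Convergence in probability and the main theorem -/

/-- `1 - l / √a = (a - l ^ 2) / (√a * (√a + l))`, and this denominator is at least `a ≥ m`. -/
theorem abs_one_sub_rpow_neg_half_mul_le {a l b m : ℝ} (hm : 0 < m) (hl : 0 ≤ l)
    (ha : m ≤ a) (hb : |a - l ^ 2| ≤ b) : |1 - a ^ (-(1 / 2) : ℝ) * l| ≤ b / m := by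
  have ha0 : 0 < a := hm.trans_le ha
  have hs : 0 < √a := Real.sqrt_pos.2 ha0
  have hrw : 1 - a ^ (-(1 / 2) : ℝ) * l = (a - l ^ 2) / (√a * (√a + l)) := by
    rw [Real.rpow_neg ha0.le, ← Real.sqrt_eq_rpow]
    have : a - l ^ 2 = (√a - l) * (√a + l) := by
      nlinarith [Real.sq_sqrt ha0.le]
    rw [this]
    field_simp
  rw [hrw, abs_div, abs_of_pos (by positivity : 0 < √a * (√a + l))]
  have hb0 : 0 ≤ b := (abs_nonneg _).trans hb
  gcongr
  calc m ≤ a := ha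
    _ = √a * √a := (Real.mul_self_sqrt ha0.le).symm
    _ ≤ √a * (√a + l) := by gcongr; linarith

theorem mainTheorem12 :
    -- `√n (1 - λ̂^{-1/2} ‖X‖) → 0` in probability
    (∀ (F : Measure ℝ) [IsProbabilityMeasure F], (∀ᵐ x ∂F, x ∈ Set.Icc (0 : ℝ) 1) →
      0 < secondMoment F →
      ∀ (Ω : ℕ → Type*) [∀ n, MeasurableSpace (Ω n)] (μ : ∀ n, Measure (Ω n))
        [∀ n, IsProbabilityMeasure (μ n)]
        (X : ∀ n, Ω n → Fin n → ℝ) (A : ∀ n, Ω n → Matrix (Fin n) (Fin n) ℝ),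
        (∀ n, IsRDPG F n (μ n) (X n) (A n)) →
        ∀ ε : ℝ, 0 < ε →
          Tendsto (fun n : ℕ => (μ n).real {ω | ε ≤ |√(n : ℝ) *
            (1 - topEigenvalue (A n ω) ^ (-(1 / 2) : ℝ) * l2norm (X n ω))|}) atTop (𝓝 0)) ∧
    -- `|λ̂ - ‖X‖²| ≤ C log(n/η)/δ²` with probability at least `1 - η`, with a universal `C`
    (∃ C : ℝ, 0 < C ∧
      ∀ (F : Measure ℝ) [IsProbabilityMeasure F], (∀ᵐ x ∂F, x ∈ Set.Icc (0 : ℝ) 1) →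
        0 < secondMoment F →
        ∀ (n : ℕ), 1 ≤ n → ∀ η : ℝ, 0 < η → η ≤ 1 / 2 →
        ∀ (Ω : Type*) [MeasurableSpace Ω] (μ : Measure Ω) [IsProbabilityMeasure μ]
          (X : Ω → Fin n → ℝ) (A : Ω → Matrix (Fin n) (Fin n) ℝ), IsRDPG F n μ X A →
          1 - η ≤ μ.real {ω | |topEigenvalue (A ω) - l2norm (X ω) ^ 2| ≤
            C * Real.log (n / η) / secondMoment F ^ 2}) ∧
    -- `|λ₁(A) - λ₁(P)| ≤ C log n` with high probability, where `P = X Xᵀ` and `λ₁(P) = ‖X‖²`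
    (∀ (F : Measure ℝ) [IsProbabilityMeasure F], (∀ᵐ x ∂F, x ∈ Set.Icc (0 : ℝ) 1) →
      0 < secondMoment F →
      ∀ c : ℝ, 0 < c → ∃ C : ℝ, 0 < C ∧
        ∀ (n : ℕ), 2 ≤ n →
        ∀ (Ω : Type*) [MeasurableSpace Ω] (μ : Measure Ω) [IsProbabilityMeasure μ]
          (X : Ω → Fin n → ℝ) (A : Ω → Matrix (Fin n) (Fin n) ℝ), IsRDPG F n μ X A →
          (∀ ω, topEigenvalue (Matrix.vecMulVec (X ω) (X ω)) = l2norm (X ω) ^ 2) ∧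
          1 - (n : ℝ) ^ (-c) ≤ μ.real {ω |
            |topEigenvalue (A ω) - topEigenvalue (Matrix.vecMulVec (X ω) (X ω))| ≤
              C * Real.log n}) := by
  refine ⟨?_, ⟨648, by norm_num, ?_⟩, ?_⟩
  · intro F _ hF hδ Ω _ μ _ X A h ε hε
    set δ := secondMoment F with hδdef
    set K : ℝ := 1296 / δ ^ 2 with hK
    have hKpos : 0 < K := by positivity
    have hlog : Tendsto (fun n : ℕ => Real.log n / √(n : ℝ)) atTop (𝓝 0) := by
      have := (isLittleO_log_rpow_atTop (r := 1 / 2) (by norm_num)).tendsto_div_nhds_zero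
      simp only [← Real.sqrt_eq_rpow] at this
      exact this.comp tendsto_natCast_atTop_atTop
    -- The `1` in the minimum keeps `λ̂ ≥ n * δ / 4`; the `ε` gives the final estimate.
    have hev : ∀ᶠ n : ℕ in atTop, Real.log n / √(n : ℝ) < min 1 ε * (δ / 4) / K :=
      hlog.eventually_lt_const (by positivity)
    have hbound : Tendsto (fun n : ℕ => 1 / (n : ℝ) + Real.exp (-(n * δ ^ 2 / 2))) atTop (𝓝 0) := by
      have h1 : Tendsto (fun n : ℕ => 1 / (n : ℝ)) atTop (𝓝 0) := tendsto_one_div_atTop_nhds_zero_nat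
      have h2 : Tendsto (fun n : ℕ => Real.exp (-(n * δ ^ 2 / 2))) atTop (𝓝 0) := by
        refine Real.tendsto_exp_neg_atTop_nhds_zero.comp ?_
        simp only [mul_div_assoc]
        exact tendsto_natCast_atTop_atTop.atTop_mul_const (by positivity)
      simpa using h1.add h2
    refine tendsto_of_tendsto_of_tendsto_of_le_of_le' tendsto_const_nhds hbound
      (.of_forall fun n => measureReal_nonneg) ?_
    filter_upwards [hev, eventually_ge_atTop 2] with n hn hn2
    have hn2' : (2 : ℝ) ≤ n := by exact_mod_cast hn2
    have hn0 : (0 : ℝ) < n := by linarith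
    have hsn : 0 < √(n : ℝ) := Real.sqrt_pos.2 hn0
    have hsq : √(n : ℝ) * √(n : ℝ) = n := Real.mul_self_sqrt hn0.le
    have hsn1 : 1 ≤ √(n : ℝ) := Real.one_le_sqrt.2 (by linarith)
    have hp1 := (h n).measureReal_l2norm_sq_le hF hδ (by omega)
    -- With `η = 1 / n`, `log (n / η) = 2 * log n`, whence `K = 2 * 648 / δ ^ 2`.
    have hp2 := (h n).measureReal_compl_abs_sub_le hF hδ (by omega) (η := 1 / (n : ℝ))
      (by positivity) (by gcongr)
    have hL : 648 * Real.log (n / (1 / (n : ℝ))) / δ ^ 2 = K * Real.log n := by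
      rw [div_div_eq_mul_div, div_one, Real.log_mul hn0.ne' hn0.ne', hK]; ring
    rw [← hδdef, hL] at hp2
    have hKn : K * Real.log n < min 1 ε * (δ / 4) * √(n : ℝ) := by
      rw [div_lt_iff₀ hsn, div_mul_eq_mul_div, lt_div_iff₀ hKpos] at hn
      linarith
    set S := {ω | |topEigenvalue (A n ω) - l2norm (X n ω) ^ 2| ≤ K * Real.log n} with hS
    calc _ ≤ (μ n).real (Sᶜ ∪ {ω | l2norm (X n ω) ^ 2 ≤ n * δ / 2}) := by
          refine measureReal_mono ?_
          intro ω hω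
          by_contra hcon
          simp only [Set.mem_union, not_or, Set.mem_compl_iff, not_not] at hcon
          obtain ⟨h1, h2⟩ := hcon
          have h1' : |topEigenvalue (A n ω) - l2norm (X n ω) ^ 2| ≤ K * Real.log n := h1
          have h2' : n * δ / 2 < l2norm (X n ω) ^ 2 := not_le.1 h2
          have hKn1 : K * Real.log n ≤ n * (δ / 4) := by
            calc K * Real.log n ≤ min 1 ε * (δ / 4) * √(n : ℝ) := hKn.le
              _ ≤ 1 * (δ / 4) * (√(n : ℝ) * √(n : ℝ)) := by
                gcongr
                · exact min_le_left _ _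
                · nlinarith
              _ = n * (δ / 4) := by rw [hsq]; ring
          have hdet := abs_one_sub_rpow_neg_half_mul_le (m := n * (δ / 4)) (by positivity)
            (norm_nonneg _) (by linarith [(abs_le.1 h1').1]) h1'
          have hω' : ε ≤ |√(n : ℝ) *
            (1 - topEigenvalue (A n ω) ^ (-(1 / 2) : ℝ) * l2norm (X n ω))| := hω
          refine absurd hω' (not_le.2 ?_)
          rw [abs_mul, abs_of_pos hsn]
          calc _ ≤ √(n : ℝ) * (K * Real.log n / (n * (δ / 4))) := by gcongr; exact hdet
            _ < √(n : ℝ) * (min 1 ε * (δ / 4) * √(n : ℝ) / (n * (δ / 4))) := by gcongr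
            _ = min 1 ε * ((√(n : ℝ) * √(n : ℝ)) / n) := by field_simp
            _ ≤ ε := by rw [hsq, div_self hn0.ne', mul_one]; exact min_le_right _ _
      _ ≤ (μ n).real Sᶜ + (μ n).real {ω | l2norm (X n ω) ^ 2 ≤ n * δ / 2} :=
          measureReal_union_le _ _
      _ ≤ _ := add_le_add hp2 hp1
  · intro F _ hF hδ n hn η hη hη2 Ω _ μ _ X A h
    exact h.one_sub_le_measureReal_abs_sub_le hF hδ hn hη hη2
  · intro F _ hF hδ c hc
    set δ := secondMoment F with hδdef
    refine ⟨648 * (2 + c) / δ ^ 2, by positivity, ?_⟩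
    intro n hn Ω _ μ _ X A h
    refine ⟨fun ω => topEigenvalue_vecMulVec_self _, ?_⟩
    simp only [topEigenvalue_vecMulVec_self]
    have hn2 : (2 : ℝ) ≤ n := by exact_mod_cast hn
    have hn0 : (0 : ℝ) < n := by linarith
    have hnc : 0 < (n : ℝ) ^ (-c) := Real.rpow_pos_of_pos hn0 _
    -- For small `c`, `n ^ (-c)` may exceed `1 / 2`. The cap costs only `log 2 ≤ log n`, hence the
    -- factor `2 + c`.
    have hη : 0 < min ((n : ℝ) ^ (-c)) (1 / 2) := lt_min hnc (by norm_num)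
    have hp := h.one_sub_le_measureReal_abs_sub_le hF hδ (by omega) hη (min_le_right _ _)
    have hlog2 : Real.log 2 ≤ Real.log n := Real.log_le_log two_pos hn2
    have hlog0 : 0 < Real.log 2 := Real.log_pos one_lt_two
    have hlog : Real.log (n / min ((n : ℝ) ^ (-c)) (1 / 2)) ≤ (2 + c) * Real.log n := by
      rw [Real.log_div hn0.ne' hη.ne']
      have hcl : 0 ≤ c * Real.log n := by nlinarith
      rcases min_choice ((n : ℝ) ^ (-c)) (1 / 2) with he | he <;> rw [he]
      · rw [Real.log_rpow hn0]; linarith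
      · rw [one_div, Real.log_inv]; linarith
    refine le_trans ?_ (hp.trans (measureReal_mono ?_))
    · linarith [min_le_left ((n : ℝ) ^ (-c)) (1 / 2)]
    · intro ω hω
      have hω' : |topEigenvalue (A ω) - l2norm (X ω) ^ 2| ≤
        648 * Real.log (n / min ((n : ℝ) ^ (-c)) (1 / 2)) / δ ^ 2 := hω
      refine hω'.trans ?_
      rw [div_mul_eq_mul_div, mul_assoc]
      gcongr
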